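/- Let $S^1$ be the unit circle centered at the origin in $\mathbb{R}^2$, and let $\nu$ be any Borel probability measure on $S^1$ (atoms are allowed). To an ordered triple $(p,q,r)\in S^1\times S^1\times S^1$ associate the triangle $\operatorname{conv}\{p,q,r\}\subset\mathbb{R}^2$. Let $\mathcal{F}\subset S^1\times S^1\times S^1$ be a Borel measurable set of triples which is intersecting, that is, for any two (not necessarily distinct) triples in $\mathcal{F}$ the interiors of the associated triangles have a common point; in particular, no triangle of $\mathcal F$ is degenerate. Then $$(\nu\times\nu\times\nu)(\mathcal{F})\le \tfrac14 .$$ -/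

import Mathlib

open MeasureTheory

/-- The unit circle `S¹` centred at the origin of the Euclidean plane, with its Borel σ-algebra. -/
abbrev UnitCircle : Type := Metric.sphere (0 : EuclideanSpace ℝ (Fin 2)) 1

/-- The (closed, possibly degenerate) triangle spanned by an ordered triple `(p, q, r)` of points
of the unit circle. -/
def triangle (T : UnitCircle × UnitCircle × UnitCircle) : Set (EuclideanSpace ℝ (Fin 2)) :=
  convexHull ℝ {(T.1 : EuclideanSpace ℝ (Fin 2)), (T.2.1 : EuclideanSpace ℝ (Fin 2)),
    (T.2.2 : EuclideanSpace ℝ (Fin 2))}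

/-- A family of ordered triples is intersecting if the triangles of any two of its members have
intersecting interiors. The two members may be equal, which says exactly that no member is
degenerate. -/
def IsIntersectingFamily (F : Set (UnitCircle × UnitCircle × UnitCircle)) : Prop :=
  ∀ T ∈ F, ∀ T' ∈ F, (interior (triangle T) ∩ interior (triangle T')).Nonempty

/-! Composing the quantile function of the angle with `circlePoint` maps Lebesgue measure on `(0,
1)` to `ν`. The angle is weakly increasing in the parameter, so a pair of parameter triples on
complementary closed arcs gives triangles separated by a chord. It therefore suffices to bound the
volume of an `IsCrossingFamily` on the circle of length 1; atoms cause no trouble because the arcs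
are closed.

There, a positively oriented triple is either central (all arcs at most 1/2) or, up to rotation, an
ear `(p, x, q)` on an arc of length at most 1/2. The central ones have volume 1/8. For an arc from
`p` to `q` of length `a ≤ 1/2`, the apexes `x` of ears over it have measure `a`, and so do the
points `r` making `(p, q, r)` central. Hence the mass of the ears in `F` over each chord can be
spread evenly over the central triples with that side (`lintegral_central_earDensity`). A central
triple then receives at most 1 in total: itself and ears over its different sides pairwise lie on
complementary arcs, so at most one of the four contributions is nonzero
(`indicator_add_earDensity_le`). Integrating bounds each orientation by 1/8. -/

open MeasureTheory ProbabilityTheory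

/-! ### Lebesgue measure as rotation-invariant measure on the circle -/

/-- Lebesgue measure on the open unit interval. -/
noncomputable def unitVolume : Measure ℝ := volume.restrict (Set.Ioo 0 1)

instance : IsProbabilityMeasure unitVolume := ⟨by simp [unitVolume]⟩

/-- Any half-open unit interval is a fundamental domain for `ℝ / ℤ`, so the image factors through
the measure on `UnitAddCircle` and does not depend on `t`. -/
lemma map_fract_restrict_Ioc (t : ℝ) :
    (volume.restrict (Set.Ioc t (t + 1))).map Int.fract = unitVolume := by
  have key : ∀ s : ℝ, (volume.restrict (Set.Ioc s (s + 1))).map Int.fract =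
      (volume : Measure UnitAddCircle).map
        (fun x => ((AddCircle.measurableEquivIco (1 : ℝ) 0 x : Set.Ico (0 : ℝ) (0 + 1)) : ℝ)) := by
    intro s
    rw [← (UnitAddCircle.measurePreserving_mk s).map_eq, Measure.map_map]
    · congr 1
      funext x
      simp only [Function.comp_apply]
      change Int.fract x = ((AddCircle.equivIco (1 : ℝ) 0 (x : AddCircle (1 : ℝ)) : _) : ℝ)
      rw [AddCircle.coe_equivIco_mk_apply]
      simp
    · exact measurable_subtype_coe.comp (MeasurableEquiv.measurable _)
    · exact AddCircle.measurable_mk'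
  rw [key t, ← key 0, zero_add, unitVolume, ← restrict_Ioo_eq_restrict_Ioc]
  conv_rhs => rw [← Measure.map_id (μ := volume.restrict (Set.Ioo (0 : ℝ) 1))]
  refine Measure.map_congr ?_
  filter_upwards [ae_restrict_mem measurableSet_Ioo] with x hx
  exact Int.fract_eq_self.2 ⟨hx.1.le, hx.2⟩

lemma measurePreserving_fract_sub (q : ℝ) :
    MeasurePreserving (fun r => Int.fract (r - q)) unitVolume unitVolume := by
  refine ⟨measurable_fract.comp (measurable_id.sub_const q), ?_⟩
  have h : (fun r : ℝ => Int.fract (r - q)) = Int.fract ∘ (fun r => r - q) := rfl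
  rw [h, ← Measure.map_map measurable_fract (by fun_prop)]
  have h2 : unitVolume.map (fun r => r - q) = volume.restrict (Set.Ioc (-q) (-q + 1)) := by
    have h3 := ((measurePreserving_sub_right (volume : Measure ℝ) q).restrict_preimage
      (s := Set.Ioc (-q) (-q + 1)) measurableSet_Ioc).map_eq
    have h4 : (fun r => r - q) ⁻¹' Set.Ioc (-q) (-q + 1) = Set.Ioc 0 1 := by
      ext x
      simp only [Set.mem_preimage, Set.mem_Ioc]
      constructor <;> rintro ⟨a, b⟩ <;> constructor <;> linarith
    rw [h4] at h3
    rw [unitVolume, restrict_Ioo_eq_restrict_Ioc, h3]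
  rw [h2, map_fract_restrict_Ioc]

/-- The length of the positively oriented arc from `p` to `q` on the circle `ℝ / ℤ`. -/
noncomputable def arcLength (p q : ℝ) : ℝ := Int.fract (q - p)

lemma arcLength_nonneg (p q : ℝ) : 0 ≤ arcLength p q := Int.fract_nonneg _
lemma arcLength_lt_one (p q : ℝ) : arcLength p q < 1 := Int.fract_lt_one _

lemma measurable_arcLength : Measurable (fun x : ℝ × ℝ => arcLength x.1 x.2) :=
  measurable_fract.comp (measurable_snd.sub measurable_fst)

@[fun_prop]
lemma Measurable.arcLength {α : Type*} [MeasurableSpace α] {f g : α → ℝ} (hf : Measurable f)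
    (hg : Measurable g) : Measurable (fun x => arcLength (f x) (g x)) :=
  measurable_arcLength.comp (hf.prodMk hg)

lemma unitVolume_arcLength_lt (p : ℝ) {a : ℝ} (ha1 : a ≤ 1) :
    unitVolume {x | arcLength p x < a} = ENNReal.ofReal a := by
  have h := (measurePreserving_fract_sub p).measure_preimage
    (s := Set.Iio a) measurableSet_Iio.nullMeasurableSet
  have h2 : unitVolume (Set.Iio a) = ENNReal.ofReal a := by
    rw [unitVolume, Measure.restrict_apply measurableSet_Iio]
    have : Set.Iio a ∩ Set.Ioo 0 1 = Set.Ioo 0 a := by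
      ext x
      simp only [Set.mem_inter_iff, Set.mem_Iio, Set.mem_Ioo]
      constructor
      · rintro ⟨h1, h2, h3⟩; exact ⟨h2, h1⟩
      · rintro ⟨h1, h2⟩; exact ⟨h2, h1, h2.trans_le ha1⟩
    rw [this]; simp
  rw [← h2, ← h]; rfl

/-- Up to a null set, the admissible `r` form the antipode of the arc from `p` to `q`. That its
measure is again `arcLength p q` is what makes the transport of ears exact. -/
lemma unitVolume_central_slice (p q : ℝ) (h : arcLength p q ≤ 1 / 2) :
    unitVolume {r | arcLength q r ≤ 1 / 2 ∧ arcLength r p ≤ 1 / 2} =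
      ENNReal.ofReal (arcLength p q) := by
  set a := arcLength p q with ha
  have ha0 : 0 ≤ a := arcLength_nonneg p q
  set S : Set ℝ := {u | u ≤ 1 / 2 ∧ Int.fract (-a - u) ≤ 1 / 2} with hS
  have hSm : MeasurableSet S := by
    apply MeasurableSet.inter (measurableSet_le measurable_id measurable_const)
    exact measurableSet_le (measurable_fract.comp (measurable_const.sub measurable_id))
      measurable_const
  have h1 := (measurePreserving_fract_sub q).measure_preimage hSm.nullMeasurableSet
  have h2 : (fun r => Int.fract (r - q)) ⁻¹' S =
      {r | arcLength q r ≤ 1 / 2 ∧ arcLength r p ≤ 1 / 2} := by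
    ext r
    have : Int.fract (-a - Int.fract (r - q)) = arcLength r p := by
      rw [arcLength, Int.fract_eq_fract]
      refine ⟨⌊q - p⌋ + ⌊r - q⌋, ?_⟩
      rw [ha, arcLength, Int.fract, Int.fract]
      push_cast
      ring
    simp only [hS, Set.mem_preimage, Set.mem_ofPred_eq, this]
    rfl
  rw [← h2, h1, unitVolume, Measure.restrict_apply hSm]
  -- The condition `0 < u` matters when `a = 0`: there `u = 0` would give 0 instead of 1.
  have hf : ∀ u, 0 < u → u ≤ 1 / 2 → Int.fract (-a - u) = 1 - a - u := by
    intro u h0 hu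
    rw [Int.fract_eq_iff]
    refine ⟨by linarith, by linarith, -1, by push_cast; ring⟩
  apply le_antisymm
  · calc _ ≤ volume (Set.Icc (1 / 2 - a) (1 / 2)) := by
          apply measure_mono
          rintro u ⟨⟨h3, h4⟩, h5, h6⟩
          rw [hf u h5 h3] at h4
          exact ⟨by linarith, h3⟩
      _ = _ := by rw [Real.volume_Icc]; congr 1; ring
  · calc _ = volume (Set.Ioc (1 / 2 - a) (1 / 2)) := by rw [Real.volume_Ioc]; congr 1; ring
      _ ≤ _ := by
          apply measure_mono
          rintro u ⟨h3, h4⟩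
          have h5 : 0 < u := by linarith
          refine ⟨⟨h4, ?_⟩, h5, by linarith⟩
          rw [hf u h5 h4]; linarith

lemma lintegral_arcLength_le_half (p : ℝ) :
    ∫⁻ q, (if arcLength p q ≤ 1 / 2 then ENNReal.ofReal (arcLength p q) else 0) ∂unitVolume
      = 1 / 8 := by
  have hm : Measurable (fun u : ℝ => if u ≤ 1 / 2 then ENNReal.ofReal u else 0) :=
    Measurable.ite (measurableSet_le measurable_id measurable_const)
      ENNReal.measurable_ofReal measurable_const
  have h := (measurePreserving_fract_sub p).lintegral_comp hm
  change ∫⁻ q, (fun u : ℝ => if u ≤ 1 / 2 then ENNReal.ofReal u else 0) (Int.fract (q - p))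
    ∂unitVolume = _
  rw [h, unitVolume]
  have h2 : (fun u : ℝ => if u ≤ 1 / 2 then ENNReal.ofReal u else 0) =
      (Set.Iic (1 / 2 : ℝ)).indicator (fun u => ENNReal.ofReal u) := by
    ext u; simp [Set.indicator_apply]
  rw [h2, lintegral_indicator measurableSet_Iic, Measure.restrict_restrict measurableSet_Iic]
  have h3 : Set.Iic (1 / 2 : ℝ) ∩ Set.Ioo 0 1 = Set.Ioc 0 (1 / 2) := by
    ext x
    simp only [Set.mem_inter_iff, Set.mem_Iic, Set.mem_Ioo, Set.mem_Ioc]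
    constructor
    · rintro ⟨h1, h2, h3⟩; exact ⟨h2, h1⟩
    · rintro ⟨h1, h2⟩; exact ⟨h2, h1, by linarith⟩
  rw [h3, ← ofReal_integral_eq_lintegral_ofReal, ← intervalIntegral.integral_of_le (by norm_num),
    integral_id]
  · rw [show ((1 / 2 : ℝ) ^ 2 - 0 ^ 2) / 2 = 1 / 8 by norm_num,
      ENNReal.ofReal_div_of_pos (by norm_num)]
    simp
  · exact (continuous_id.integrableOn_Icc).mono_set Set.Ioc_subset_Icc_self
  · filter_upwards [ae_restrict_mem measurableSet_Ioc] with x hx using hx.1.le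

/-! ### Quantile functions -/

open Classical in
/-- The quantile function of a probability measure on the line, extended by zero from `(0, 1)`. -/
noncomputable def quantile (μ : Measure ℝ) (u : ℝ) : ℝ :=
  if u ∈ Set.Ioo (0 : ℝ) 1 then sInf {x | u ≤ cdf μ x} else 0

/-- Right continuity of the cdf makes the infimum attained; the limits at infinity make the set
nonempty and bounded below. -/
lemma quantile_le_iff (μ : Measure ℝ) {u : ℝ} (h0 : 0 < u) (h1 : u < 1) (x : ℝ) :
    quantile μ u ≤ x ↔ u ≤ cdf μ x := by
  rw [quantile, if_pos ⟨h0, h1⟩]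
  set S := {x | u ≤ cdf μ x} with hS
  have hne : S.Nonempty :=
    ((tendsto_cdf_atTop μ).eventually (eventually_ge_nhds h1)).exists
  have hbdd : BddBelow S := by
    obtain ⟨y, hy⟩ := ((tendsto_cdf_atBot μ).eventually (eventually_lt_nhds h0)).exists
    refine ⟨y, fun z hz => ?_⟩
    by_contra hlt
    exact absurd (hz.trans (monotone_cdf μ (not_le.1 hlt).le)) (not_le.2 hy)
  constructor
  · intro h
    have hright : Filter.Tendsto (cdf μ) (nhdsWithin x (Set.Ioi x)) (nhds (cdf μ x)) :=
      ((cdf μ).right_continuous x).mono_left (nhdsWithin_mono _ Set.Ioi_subset_Ici_self)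
    refine ge_of_tendsto hright ?_
    filter_upwards [self_mem_nhdsWithin] with y hy
    obtain ⟨z, hz, hzy⟩ := (csInf_lt_iff hbdd hne).1 (lt_of_le_of_lt h hy)
    exact le_trans hz (monotone_cdf μ hzy.le)
  · intro h
    exact csInf_le hbdd h

lemma monotoneOn_quantile (μ : Measure ℝ) : MonotoneOn (quantile μ) (Set.Ioo 0 1) := by
  intro u hu v hv huv
  rw [quantile_le_iff μ hu.1 hu.2]
  exact huv.trans ((quantile_le_iff μ hv.1 hv.2 _).1 le_rfl)

lemma measurable_quantile (μ : Measure ℝ) : Measurable (quantile μ) := by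
  refine measurable_of_Iic fun x => ?_
  have h : quantile μ ⁻¹' Set.Iic x = (Set.Ioo 0 1 ∩ Set.Iic (cdf μ x)) ∪
      ((Set.Ioo (0 : ℝ) 1)ᶜ ∩ {_u : ℝ | 0 ≤ x}) := by
    ext u
    by_cases hu : u ∈ Set.Ioo (0 : ℝ) 1
    · have := quantile_le_iff μ hu.1 hu.2 x
      simpa [hu.1, hu.2] using this
    · have : quantile μ u = 0 := by rw [quantile, if_neg hu]
      simp only [Set.mem_preimage, Set.mem_Iic, this, Set.mem_union, Set.mem_inter_iff, hu,
        Set.mem_compl_iff, not_false_eq_true, true_and, false_and, false_or, Set.mem_ofPred_eq]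
  rw [h]
  exact (measurableSet_Ioo.inter measurableSet_Iic).union
    (measurableSet_Ioo.compl.inter (MeasurableSet.const _))

lemma map_quantile (μ : Measure ℝ) [IsProbabilityMeasure μ] :
    unitVolume.map (quantile μ) = μ := by
  have : IsProbabilityMeasure (unitVolume.map (quantile μ)) :=
    Measure.isProbabilityMeasure_map (measurable_quantile μ).aemeasurable
  refine Measure.ext_of_Iic _ _ fun x => ?_
  rw [Measure.map_apply (measurable_quantile μ) measurableSet_Iic,
    ← ofReal_cdf μ x, unitVolume, Measure.restrict_apply' measurableSet_Ioo]
  have h1 := cdf_le_one μ x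
  apply le_antisymm
  · calc _ ≤ volume (Set.Ioc 0 (cdf μ x)) := by
          apply measure_mono
          rintro u ⟨hu, hu0, hu1⟩
          exact ⟨hu0, (quantile_le_iff μ hu0 hu1 x).1 hu⟩
      _ = _ := by simp
  · calc _ = volume (Set.Ioo 0 (cdf μ x)) := by simp
      _ ≤ _ := by
          apply measure_mono
          rintro u ⟨hu0, hu⟩
          have hu1 := hu.trans_le h1
          exact ⟨(quantile_le_iff μ hu0 hu1 x).2 hu.le, hu0, hu1⟩

/-! ### Arcs, central triples and short triples -/

lemma arcLength_self (p : ℝ) : arcLength p p = 0 := by simp [arcLength]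

lemma arcLength_swap {p q : ℝ} (h : 0 < arcLength p q) : arcLength q p = 1 - arcLength p q := by
  unfold arcLength at *
  rw [← neg_sub q p, Int.fract_neg h.ne']

lemma arcLength_pos {p q : ℝ} (hp : p ∈ Set.Ioo (0 : ℝ) 1) (hq : q ∈ Set.Ioo (0 : ℝ) 1)
    (h : p ≠ q) : 0 < arcLength p q := by
  refine (arcLength_nonneg p q).lt_of_ne fun h0 => h ?_
  obtain ⟨n, hn⟩ := Int.fract_eq_zero_iff.1 h0.symm
  have h1 : (n : ℝ) < 1 := by rw [hn]; linarith [hp.1, hq.2]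
  have h2 : (-1 : ℝ) < n := by rw [hn]; linarith [hp.2, hq.1]
  have h3 : n < 1 := by exact_mod_cast h1
  have h4 : -1 < n := by exact_mod_cast h2
  have h5 : n = 0 := by omega
  rw [h5] at hn
  push_cast at hn
  linarith

lemma exists_int_arcLength_sum (p q r : ℝ) :
    ∃ n : ℤ, arcLength p q + arcLength q r + arcLength r p = n := by
  refine ⟨-(⌊q - p⌋ + ⌊r - q⌋ + ⌊p - r⌋), ?_⟩
  simp only [arcLength, Int.fract]
  push_cast
  ring

/-- The ordered triples cutting the circle `ℝ / ℤ` into three positively oriented arcs of length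
at most `1 / 2`. -/
def centralTriples : Set (ℝ × ℝ × ℝ) :=
  {T | arcLength T.1 T.2.1 ≤ 1 / 2 ∧ arcLength T.2.1 T.2.2 ≤ 1 / 2 ∧ arcLength T.2.2 T.1 ≤ 1 / 2}

/-- The ordered triples which are positively oriented and lie on an arc of length at most `1 / 2`
from the first point to the third. -/
def shortTriples : Set (ℝ × ℝ × ℝ) :=
  {T | arcLength T.1 T.2.1 < arcLength T.1 T.2.2 ∧ arcLength T.1 T.2.2 ≤ 1 / 2}

lemma measurableSet_centralTriples : MeasurableSet centralTriples := by
  have h1 : MeasurableSet {T : ℝ × ℝ × ℝ | arcLength T.1 T.2.1 ≤ 1 / 2} :=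
    measurableSet_le (by fun_prop) (by fun_prop)
  have h2 : MeasurableSet {T : ℝ × ℝ × ℝ | arcLength T.2.1 T.2.2 ≤ 1 / 2} :=
    measurableSet_le (by fun_prop) (by fun_prop)
  have h3 : MeasurableSet {T : ℝ × ℝ × ℝ | arcLength T.2.2 T.1 ≤ 1 / 2} :=
    measurableSet_le (by fun_prop) (by fun_prop)
  exact h1.inter (h2.inter h3)

lemma measurableSet_shortTriples : MeasurableSet shortTriples := by
  have h1 : MeasurableSet {T : ℝ × ℝ × ℝ | arcLength T.1 T.2.1 < arcLength T.1 T.2.2} :=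
    measurableSet_lt (by fun_prop) (by fun_prop)
  have h2 : MeasurableSet {T : ℝ × ℝ × ℝ | arcLength T.1 T.2.2 ≤ 1 / 2} :=
    measurableSet_le (by fun_prop) (by fun_prop)
  exact h1.inter h2

lemma centralTriples_rotate {p q r : ℝ} (h : (p, q, r) ∈ centralTriples) :
    (q, r, p) ∈ centralTriples := ⟨h.2.1, h.2.2, h.1⟩

/-- The three arcs sum to an integer in `(0, 2)`, hence to 1, so `r` lies on the arc from `q` back
to `p`. -/
lemma arcLength_le_of_central {p q r : ℝ} (h : (p, q, r) ∈ centralTriples)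
    (h0 : 0 < arcLength p q) : arcLength q r ≤ arcLength q p := by
  obtain ⟨n, hn⟩ := exists_int_arcLength_sum p q r
  obtain ⟨h1, h2, h3⟩ := h
  simp only at h1 h2 h3
  have h4 := arcLength_nonneg q r
  have h5 := arcLength_nonneg r p
  have h6 : (0 : ℝ) < n := by linarith
  have h7 : (n : ℝ) < 2 := by linarith
  have h8 : 0 < n := by exact_mod_cast h6
  have h9 : n < 2 := by exact_mod_cast h7
  have h10 : n = 1 := by omega
  rw [h10] at hn
  push_cast at hn
  rw [arcLength_swap h0]
  linarith

/-- At most one arc exceeds 1/2; removing it leaves all three points on the complementary short arc.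
-/
lemma mem_central_or_short_of_sum_eq_one {p q r : ℝ} (hpq : 0 < arcLength p q)
    (hqr : 0 < arcLength q r) (hrp : 0 < arcLength r p)
    (h : arcLength p q + arcLength q r + arcLength r p = 1) :
    (p, q, r) ∈ centralTriples ∨ (p, q, r) ∈ shortTriples ∨ (q, r, p) ∈ shortTriples ∨
      (r, p, q) ∈ shortTriples := by
  by_cases h1 : arcLength p q ≤ 1 / 2
  · by_cases h2 : arcLength q r ≤ 1 / 2
    · by_cases h3 : arcLength r p ≤ 1 / 2
      · exact Or.inl ⟨h1, h2, h3⟩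
      · right; left
        constructor <;> simp only [arcLength_swap hrp] <;> linarith
    · right; right; right
      constructor <;> simp only [arcLength_swap hqr] <;> linarith
  · right; right; left
    constructor <;> simp only [arcLength_swap hpq] <;> linarith

/-- The sum is 1 or 2 according to orientation, and reversing every arc turns `s` into `3 - s`. -/
lemma arcLength_sum_eq_one_or {p q r : ℝ} (hpq : 0 < arcLength p q)
    (hqr : 0 < arcLength q r) (hrp : 0 < arcLength r p) :
    arcLength p q + arcLength q r + arcLength r p = 1 ∨
      arcLength q p + arcLength p r + arcLength r q = 1 := by
  obtain ⟨n, hn⟩ := exists_int_arcLength_sum p q r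
  have h1 := arcLength_lt_one p q
  have h2 := arcLength_lt_one q r
  have h3 := arcLength_lt_one r p
  have h6 : (0 : ℝ) < n := by linarith
  have h7 : (n : ℝ) < 3 := by linarith
  have h8 : 0 < n := by exact_mod_cast h6
  have h9 : n < 3 := by exact_mod_cast h7
  rw [arcLength_swap hpq, arcLength_swap hqr, arcLength_swap hrp]
  obtain h10 | h10 : n = 1 ∨ n = 2 := by omega
  · left; rw [hn, h10]; norm_num
  · right; rw [h10] at hn; push_cast at hn; linarith

/-! ### Crossing families -/

lemma arcLength_of_le {p x : ℝ} (hp : p ∈ Set.Ioo (0 : ℝ) 1) (hx : x ∈ Set.Ioo (0 : ℝ) 1)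
    (h : p ≤ x) : arcLength p x = x - p :=
  Int.fract_eq_self.2 ⟨by linarith, by linarith [hp.1, hx.2]⟩

lemma arcLength_of_lt {p x : ℝ} (hp : p ∈ Set.Ioo (0 : ℝ) 1) (hx : x ∈ Set.Ioo (0 : ℝ) 1)
    (h : x < p) : arcLength p x = x - p + 1 := by
  rw [arcLength, Int.fract_eq_iff]
  exact ⟨by linarith [hp.2, hx.1], by linarith, -1, by push_cast; ring⟩

lemma mem_Icc_of_arcLength_le {p q x : ℝ} (hp : p ∈ Set.Ioo (0 : ℝ) 1)
    (hq : q ∈ Set.Ioo (0 : ℝ) 1) (hx : x ∈ Set.Ioo (0 : ℝ) 1) (hpq : p ≤ q)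
    (h : arcLength p x ≤ arcLength p q) : p ≤ x ∧ x ≤ q := by
  rw [arcLength_of_le hp hq hpq] at h
  rcases le_or_gt p x with hpx | hpx
  · rw [arcLength_of_le hp hx hpx] at h
    exact ⟨hpx, by linarith⟩
  · rw [arcLength_of_lt hp hx hpx] at h
    linarith [hx.1, hq.2]

lemma le_or_le_of_arcLength_le {p q x : ℝ} (hp : p ∈ Set.Ioo (0 : ℝ) 1)
    (hq : q ∈ Set.Ioo (0 : ℝ) 1) (hx : x ∈ Set.Ioo (0 : ℝ) 1) (hpq : p ≤ q)
    (h : arcLength q x ≤ arcLength q p) : x ≤ p ∨ q ≤ x := by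
  rcases le_or_gt q x with hqx | hqx
  · exact Or.inr hqx
  · left
    rw [arcLength_of_lt hq hx hqx] at h
    rcases hpq.eq_or_lt with rfl | hlt
    · exact hqx.le
    · rw [arcLength_of_lt hq hp hlt] at h
      linarith

/-- A symmetric set of triples of `(0, 1)`, viewed as points on a circle, no two of which lie on
complementary closed arcs. -/
structure IsCrossingFamily (F : Set (ℝ × ℝ × ℝ)) : Prop where
  mem_Ioo : ∀ {a b c : ℝ}, (a, b, c) ∈ F → ∀ x ∈ ({a, b, c} : Set ℝ), x ∈ Set.Ioo (0 : ℝ) 1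
  swap : ∀ {a b c : ℝ}, (a, b, c) ∈ F → (b, a, c) ∈ F
  rotate : ∀ {a b c : ℝ}, (a, b, c) ∈ F → (b, c, a) ∈ F
  crossing : ∀ {a b c a' b' c' u v : ℝ}, u ∈ Set.Ioo (0 : ℝ) 1 → v ∈ Set.Ioo (0 : ℝ) 1 → u ≤ v →
    (a, b, c) ∈ F → (a', b', c') ∈ F → (∀ x ∈ ({a, b, c} : Set ℝ), u ≤ x ∧ x ≤ v) →
    ¬ ∀ x ∈ ({a', b', c'} : Set ℝ), x ≤ u ∨ v ≤ x

namespace IsCrossingFamily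

variable {F : Set (ℝ × ℝ × ℝ)} (hF : IsCrossingFamily F)
include hF

/-- Rotation-invariant form of `crossing`. If `q ≤ p`, the arc from `q` to `p` is the one avoiding
the cut at 0, so the two triples exchange roles. -/
lemma not_complementary_arcs {a b c a' b' c' p q : ℝ} (hp : p ∈ Set.Ioo (0 : ℝ) 1)
    (hq : q ∈ Set.Ioo (0 : ℝ) 1) (h : (a, b, c) ∈ F) (h' : (a', b', c') ∈ F)
    (hT : ∀ x ∈ ({a, b, c} : Set ℝ), arcLength p x ≤ arcLength p q) :
    ¬ ∀ x ∈ ({a', b', c'} : Set ℝ), arcLength q x ≤ arcLength q p := by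
  intro hT'
  rcases le_total p q with hpq | hpq
  · exact hF.crossing hp hq hpq h h'
      (fun x hx => mem_Icc_of_arcLength_le hp hq (hF.mem_Ioo h x hx) hpq (hT x hx))
      (fun x hx => le_or_le_of_arcLength_le hp hq (hF.mem_Ioo h' x hx) hpq (hT' x hx))
  · exact hF.crossing hq hp hpq h' h
      (fun x hx => mem_Icc_of_arcLength_le hq hp (hF.mem_Ioo h' x hx) hpq (hT' x hx))
      (fun x hx => le_or_le_of_arcLength_le hq hp (hF.mem_Ioo h x hx) hpq (hT x hx))

/-- A triple `(a, a, c)` lies on both closed arcs between `a` and `c`, contradicting `crossing` with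
itself. -/
lemma fst_ne_snd {a b c : ℝ} (h : (a, b, c) ∈ F) : a ≠ b := by
  rintro rfl
  have ha := hF.mem_Ioo h a (by simp)
  have hc := hF.mem_Ioo h c (by simp)
  refine hF.not_complementary_arcs ha hc h h ?_ ?_ <;>
    rintro x (rfl | rfl | rfl) <;> simp [arcLength_self, arcLength_nonneg]

lemma mem_central_or_short {p q r : ℝ} (h : (p, q, r) ∈ F) :
    ((p, q, r) ∈ centralTriples ∨ (p, q, r) ∈ shortTriples ∨ (q, r, p) ∈ shortTriples ∨
      (r, p, q) ∈ shortTriples) ∨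
    ((q, p, r) ∈ centralTriples ∨ (q, p, r) ∈ shortTriples ∨ (p, r, q) ∈ shortTriples ∨
      (r, q, p) ∈ shortTriples) := by
  have hp := hF.mem_Ioo h p (by simp)
  have hq := hF.mem_Ioo h q (by simp)
  have hr := hF.mem_Ioo h r (by simp)
  have hpq := hF.fst_ne_snd h
  have hqr := hF.fst_ne_snd (hF.rotate h)
  have hrp := hF.fst_ne_snd (hF.rotate (hF.rotate h))
  have hpq' := arcLength_pos hp hq hpq
  have hqr' := arcLength_pos hq hr hqr
  have hrp' := arcLength_pos hr hp hrp
  refine (arcLength_sum_eq_one_or hpq' hqr' hrp').imp ?_ ?_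
  · exact mem_central_or_short_of_sum_eq_one hpq' hqr' hrp'
  · exact mem_central_or_short_of_sum_eq_one (arcLength_pos hq hp hpq.symm)
      (arcLength_pos hp hr hrp.symm) (arcLength_pos hr hq hqr.symm)

/-- The chord from `p` to `q` separates the central triangle from the ear over that side. -/
lemma central_short_false {p q r x : ℝ} (hC : (p, q, r) ∈ centralTriples) (h : (p, q, r) ∈ F)
    (hS : (p, x, q) ∈ shortTriples ∩ F) : False := by
  have hx : arcLength p x < arcLength p q := hS.1.1
  have h0 := (arcLength_nonneg p x).trans_lt hx
  have h1 := arcLength_le_of_central hC h0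
  refine hF.not_complementary_arcs (hF.mem_Ioo hS.2 p (by simp)) (hF.mem_Ioo hS.2 q (by simp))
    hS.2 h ?_ ?_
  · rintro y (rfl | rfl | rfl) <;> simp [arcLength_self, arcLength_nonneg, hx.le]
  · rintro y (rfl | rfl | rfl) <;> simp [arcLength_self, arcLength_nonneg, h1]

/-- The chord from `p` to `q` also separates the ears over two consecutive sides. -/
lemma short_short_false {p q r x y : ℝ} (hC : (p, q, r) ∈ centralTriples)
    (hS : (p, x, q) ∈ shortTriples ∩ F) (hS' : (q, y, r) ∈ shortTriples ∩ F) : False := by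
  have hx : arcLength p x < arcLength p q := hS.1.1
  have hy : arcLength q y < arcLength q r := hS'.1.1
  have h0 := (arcLength_nonneg p x).trans_lt hx
  have h1 := arcLength_le_of_central hC h0
  refine hF.not_complementary_arcs (hF.mem_Ioo hS.2 p (by simp)) (hF.mem_Ioo hS.2 q (by simp))
    hS.2 hS'.2 ?_ ?_
  · rintro y (rfl | rfl | rfl) <;> simp [arcLength_self, arcLength_nonneg, hx.le]
  · rintro y (rfl | rfl | rfl) <;> simp [arcLength_self, arcLength_nonneg, h1, (hy.trans_le h1).le]

end IsCrossingFamily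

/-! ### Volume of triples and the spreading of ears -/

/-- Lebesgue measure on the open unit cube. -/
noncomputable def cubeVolume : Measure (ℝ × ℝ × ℝ) := unitVolume.prod (unitVolume.prod unitVolume)

lemma measurePreserving_rotate {α : Type*} [MeasurableSpace α] (μ : Measure α) [SFinite μ] :
    MeasurePreserving (fun T : α × α × α => (T.2.1, T.2.2, T.1))
      (μ.prod (μ.prod μ)) (μ.prod (μ.prod μ)) :=
  (measurePreserving_prodAssoc μ μ μ).comp
    (Measure.measurePreserving_swap (μ := μ) (ν := μ.prod μ))

lemma measurePreserving_swap_fst_snd {α : Type*} [MeasurableSpace α] (μ : Measure α) [SFinite μ] :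
    MeasurePreserving (fun T : α × α × α => (T.2.1, T.1, T.2.2))
      (μ.prod (μ.prod μ)) (μ.prod (μ.prod μ)) :=
  (measurePreserving_prodAssoc μ μ μ).comp
    (((Measure.measurePreserving_swap (μ := μ) (ν := μ)).prod (MeasurePreserving.id μ)).comp
      ((measurePreserving_prodAssoc μ μ μ).symm MeasurableEquiv.prodAssoc))

lemma lintegral_cubeVolume {g : ℝ × ℝ × ℝ → ENNReal} (hg : Measurable g) :
    ∫⁻ T, g T ∂cubeVolume =
      ∫⁻ p, ∫⁻ q, ∫⁻ r, g (p, q, r) ∂unitVolume ∂unitVolume ∂unitVolume := by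
  rw [cubeVolume, lintegral_prod _ hg.aemeasurable]
  refine lintegral_congr fun p => ?_
  exact lintegral_prod (fun z : ℝ × ℝ => g (p, z)) (by fun_prop)

lemma lintegral_centralTriples_slice (p q : ℝ) :
    ∫⁻ r, centralTriples.indicator 1 (p, q, r) ∂unitVolume =
      if arcLength p q ≤ 1 / 2 then ENNReal.ofReal (arcLength p q) else 0 := by
  have hm : MeasurableSet ((fun r => (p, q, r)) ⁻¹' centralTriples) :=
    measurableSet_centralTriples.preimage (by fun_prop)
  have h1 : (fun r => centralTriples.indicator (1 : ℝ × ℝ × ℝ → ENNReal) (p, q, r)) =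
      ((fun r => (p, q, r)) ⁻¹' centralTriples).indicator 1 := by
    rfl
  rw [h1, lintegral_indicator_one hm]
  split_ifs with h
  · rw [← unitVolume_central_slice p q h]
    congr 1
    ext r
    exact and_iff_right h
  · have : (fun r => (p, q, r)) ⁻¹' centralTriples = ∅ := by
      ext r
      simp only [Set.mem_preimage, Set.mem_empty_iff_false, iff_false]
      exact fun hr => h hr.1
    rw [this, measure_empty]

lemma cubeVolume_centralTriples : cubeVolume centralTriples = 1 / 8 := by
  rw [← lintegral_indicator_one measurableSet_centralTriples,
    lintegral_cubeVolume (measurable_one.indicator measurableSet_centralTriples)]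
  simp_rw [lintegral_centralTriples_slice, lintegral_arcLength_le_half]
  simp

/-- The proportion of the points `x` of the arc from `p` to `q` for which the triple `(p, x, q)` is
a short triple of `F`. -/
noncomputable def earDensity (F : Set (ℝ × ℝ × ℝ)) (p q : ℝ) : ENNReal :=
  (ENNReal.ofReal (arcLength p q))⁻¹ *
    ∫⁻ x, (shortTriples ∩ F).indicator 1 (p, x, q) ∂unitVolume

section earDensity

variable {F : Set (ℝ × ℝ × ℝ)}

lemma measurable_earDensity (hF : MeasurableSet F) {α : Type*} [MeasurableSpace α] {f g : α → ℝ}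
    (hf : Measurable f) (hg : Measurable g) : Measurable (fun a => earDensity F (f a) (g a)) := by
  have h : Measurable (fun w : (ℝ × ℝ) × ℝ =>
      (shortTriples ∩ F).indicator (1 : ℝ × ℝ × ℝ → ENNReal) (w.1.1, w.2, w.1.2)) :=
    (measurable_one.indicator (measurableSet_shortTriples.inter hF)).comp (by fun_prop)
  have h2 : Measurable (fun z : ℝ × ℝ => (ENNReal.ofReal (arcLength z.1 z.2))⁻¹) := by fun_prop
  have h3 : Measurable (fun z : ℝ × ℝ => earDensity F z.1 z.2) := h2.mul h.lintegral_prod_right'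
  fun_prop

/-- Apexes lie on the arc from `p` to `q`, whose measure is the normalizing factor. -/
lemma earDensity_le_one (F : Set (ℝ × ℝ × ℝ)) (p q : ℝ) : earDensity F p q ≤ 1 := by
  have h : ∫⁻ x, (shortTriples ∩ F).indicator 1 (p, x, q) ∂unitVolume ≤
      ENNReal.ofReal (arcLength p q) := by
    have hm : MeasurableSet {x | arcLength p x < arcLength p q} :=
      measurableSet_lt (by fun_prop) (by fun_prop)
    rw [← unitVolume_arcLength_lt p (arcLength_lt_one p q).le, ← lintegral_indicator_one hm]
    refine lintegral_mono fun x => ?_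
    by_cases hx : (p, x, q) ∈ shortTriples ∩ F
    · have : x ∈ {x | arcLength p x < arcLength p q} := hx.1.1
      simp [Set.indicator_of_mem this, Set.indicator_of_mem hx]
    · simp [Set.indicator_of_notMem hx]
  calc _ ≤ (ENNReal.ofReal (arcLength p q))⁻¹ * ENNReal.ofReal (arcLength p q) := by
        unfold earDensity; gcongr
    _ ≤ 1 := ENNReal.inv_mul_le_one _

lemma exists_of_earDensity_ne_zero {p q : ℝ} (h : earDensity F p q ≠ 0) :
    ∃ x, (p, x, q) ∈ shortTriples ∩ F := by
  by_contra! hx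
  apply h
  have : ∀ x, (shortTriples ∩ F).indicator (1 : ℝ × ℝ × ℝ → ENNReal) (p, x, q) = 0 :=
    fun x => Set.indicator_of_notMem (hx x) _
  simp [earDensity, this]

lemma ofReal_arcLength_mul_earDensity (p q : ℝ) :
    (if arcLength p q ≤ 1 / 2 then ENNReal.ofReal (arcLength p q) else 0) * earDensity F p q =
      ∫⁻ x, (shortTriples ∩ F).indicator 1 (p, x, q) ∂unitVolume := by
  by_cases h : arcLength p q ≤ 1 / 2 ∧ 0 < arcLength p q
  · rw [if_pos h.1, earDensity, ← mul_assoc, ENNReal.mul_inv_cancel, one_mul]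
    · simpa using h.2
    · simp
  -- No ear sits over an arc that is too long or trivial; in the trivial case the density is `⊤ * 0
  -- = 0`.
  · have hx : ∀ x, (shortTriples ∩ F).indicator (1 : ℝ × ℝ × ℝ → ENNReal) (p, x, q) = 0 := by
      intro x
      refine Set.indicator_of_notMem (fun hx => h ?_) _
      exact ⟨hx.1.2, (arcLength_nonneg p x).trans_lt hx.1.1⟩
    simp [earDensity, hx]

/-- For fixed `p` and `q`, integrating over `r` multiplies the density by the measure of the central
slice, which cancels its denominator and returns the measure of the apexes. -/
lemma lintegral_central_earDensity (hF : MeasurableSet F) :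
    ∫⁻ T, centralTriples.indicator 1 T * earDensity F T.1 T.2.1 ∂cubeVolume =
      cubeVolume (shortTriples ∩ F) := by
  have hS := measurableSet_shortTriples.inter hF
  have hm : Measurable (centralTriples.indicator (1 : ℝ × ℝ × ℝ → ENNReal)) :=
    measurable_one.indicator measurableSet_centralTriples
  have hW : Measurable (fun T : ℝ × ℝ × ℝ => earDensity F T.1 T.2.1) :=
    measurable_earDensity hF (by fun_prop) (by fun_prop)
  have hmW : Measurable (fun T : ℝ × ℝ × ℝ =>
      centralTriples.indicator 1 T * earDensity F T.1 T.2.1) := hm.mul hW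
  have hS' : Measurable ((shortTriples ∩ F).indicator (1 : ℝ × ℝ × ℝ → ENNReal)) :=
    measurable_one.indicator hS
  rw [lintegral_cubeVolume hmW, ← lintegral_indicator_one hS,
    lintegral_cubeVolume hS']
  refine lintegral_congr fun p => ?_
  -- The apex is the middle coordinate of an ear, so it must be integrated first to match `r`.
  rw [lintegral_lintegral_swap (f := fun x q =>
    (shortTriples ∩ F).indicator (1 : ℝ × ℝ × ℝ → ENNReal) (p, x, q))]
  · refine lintegral_congr fun q => ?_
    dsimp only
    have hmr : Measurable (fun r : ℝ =>
      centralTriples.indicator (1 : ℝ × ℝ × ℝ → ENNReal) (p, q, r)) := by fun_prop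
    rw [lintegral_mul_const _ hmr, lintegral_centralTriples_slice,
      ofReal_arcLength_mul_earDensity]
  · have : Measurable (fun z : ℝ × ℝ =>
      (shortTriples ∩ F).indicator (1 : ℝ × ℝ × ℝ → ENNReal) (p, z.1, z.2)) := by fun_prop
    exact this.aemeasurable

end earDensity

lemma add_four_le_one {a b c d : ENNReal} (ha : a ≤ 1) (hb : b ≤ 1) (hc : c ≤ 1) (hd : d ≤ 1)
    (hab : a = 0 ∨ b = 0) (hac : a = 0 ∨ c = 0) (had : a = 0 ∨ d = 0) (hbc : b = 0 ∨ c = 0)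
    (hcd : c = 0 ∨ d = 0) (hdb : d = 0 ∨ b = 0) : a + b + c + d ≤ 1 := by
  rcases eq_or_ne a 0 with rfl | h
  · rcases eq_or_ne b 0 with rfl | h
    · rcases hcd with rfl | rfl <;> simpa
    · have h1 := hbc.resolve_left h
      have h2 := hdb.resolve_right h
      simpa [h1, h2]
  · simpa [hab.resolve_left h, hac.resolve_left h, had.resolve_left h]

/-! ### The bound for crossing families -/

namespace IsCrossingFamily

variable {F : Set (ℝ × ℝ × ℝ)}

lemma indicator_add_earDensity_le (hF : IsCrossingFamily F) {p q r : ℝ}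
    (hC : (p, q, r) ∈ centralTriples) :
    F.indicator 1 (p, q, r) + earDensity F p q + earDensity F q r + earDensity F r p ≤ 1 := by
  have central : ∀ {p q r : ℝ}, (p, q, r) ∈ centralTriples →
      ((p, q, r) ∉ F ∨ earDensity F p q = 0) := by
    intro p q r hC
    by_contra! h
    obtain ⟨x, hx⟩ := exists_of_earDensity_ne_zero h.2
    exact hF.central_short_false hC h.1 hx
  have ears : ∀ {p q r : ℝ}, (p, q, r) ∈ centralTriples →
      (earDensity F p q = 0 ∨ earDensity F q r = 0) := by
    intro p q r hC
    by_contra! h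
    obtain ⟨x, hx⟩ := exists_of_earDensity_ne_zero h.1
    obtain ⟨y, hy⟩ := exists_of_earDensity_ne_zero h.2
    exact hF.short_short_false hC hx hy
  have hC' := centralTriples_rotate hC
  have hC'' := centralTriples_rotate hC'
  have hzero : (p, q, r) ∉ F → F.indicator (1 : ℝ × ℝ × ℝ → ENNReal) (p, q, r) = 0 :=
    fun h => Set.indicator_of_notMem h _
  refine add_four_le_one (Set.indicator_le_self' (by simp) _) (earDensity_le_one F _ _)
    (earDensity_le_one F _ _) (earDensity_le_one F _ _) ((central hC).imp_left hzero)
    ((central hC').imp_left fun h => hzero fun h' => h (hF.rotate h'))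
    ((central hC'').imp_left fun h => hzero fun h' => h (hF.rotate (hF.rotate h')))
    (ears hC) (ears hC') (ears hC'')

lemma cubeVolume_central_add_short_le (hF : IsCrossingFamily F) (hm : MeasurableSet F) :
    cubeVolume (centralTriples ∩ F) + 3 * cubeVolume (shortTriples ∩ F) ≤ 1 / 8 := by
  have hC : Measurable (centralTriples.indicator (1 : ℝ × ℝ × ℝ → ENNReal)) :=
    measurable_one.indicator measurableSet_centralTriples
  have hW : Measurable (fun T : ℝ × ℝ × ℝ => earDensity F T.1 T.2.1) :=
    measurable_earDensity hm (by fun_prop) (by fun_prop)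
  have hW' : Measurable (fun T : ℝ × ℝ × ℝ => earDensity F T.2.1 T.2.2) :=
    measurable_earDensity hm (by fun_prop) (by fun_prop)
  have hW'' : Measurable (fun T : ℝ × ℝ × ℝ => earDensity F T.2.2 T.1) :=
    measurable_earDensity hm (by fun_prop) (by fun_prop)
  have hCW : Measurable (fun T : ℝ × ℝ × ℝ =>
      centralTriples.indicator 1 T * earDensity F T.1 T.2.1) := hC.mul hW
  have hCW' : Measurable (fun T : ℝ × ℝ × ℝ =>
      centralTriples.indicator 1 T * earDensity F T.2.1 T.2.2) := hC.mul hW'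
  have hCW'' : Measurable (fun T : ℝ × ℝ × ℝ =>
      centralTriples.indicator 1 T * earDensity F T.2.2 T.1) := hC.mul hW''
  have hrot : ∀ T : ℝ × ℝ × ℝ,
      centralTriples.indicator (1 : ℝ × ℝ × ℝ → ENNReal) (T.2.1, T.2.2, T.1) =
        centralTriples.indicator 1 T := by
    intro T
    by_cases h : T ∈ centralTriples
    · rw [Set.indicator_of_mem h, Set.indicator_of_mem (centralTriples_rotate h)]; rfl
    · rw [Set.indicator_of_notMem h, Set.indicator_of_notMem]
      exact fun h' => h (centralTriples_rotate (centralTriples_rotate h'))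
  have e1 := lintegral_central_earDensity hm
  have e2 : ∫⁻ T, centralTriples.indicator 1 T * earDensity F T.2.1 T.2.2 ∂cubeVolume =
      cubeVolume (shortTriples ∩ F) := by
    rw [← e1, cubeVolume, ← (measurePreserving_rotate unitVolume).lintegral_comp hCW]
    simp only [hrot]
  have e3 : ∫⁻ T, centralTriples.indicator 1 T * earDensity F T.2.2 T.1 ∂cubeVolume =
      cubeVolume (shortTriples ∩ F) := by
    rw [← e2, cubeVolume, ← (measurePreserving_rotate unitVolume).lintegral_comp hCW']
    simp only [hrot]
  have e0 : ∫⁻ T, centralTriples.indicator 1 T * F.indicator 1 T ∂cubeVolume =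
      cubeVolume (centralTriples ∩ F) := by
    rw [← lintegral_indicator_one (measurableSet_centralTriples.inter hm),
      Set.inter_indicator_one]
    rfl
  calc cubeVolume (centralTriples ∩ F) + 3 * cubeVolume (shortTriples ∩ F)
      = ∫⁻ T, (centralTriples.indicator 1 T * F.indicator 1 T +
          centralTriples.indicator 1 T * earDensity F T.1 T.2.1 +
          centralTriples.indicator 1 T * earDensity F T.2.1 T.2.2 +
          centralTriples.indicator 1 T * earDensity F T.2.2 T.1) ∂cubeVolume := by
        rw [lintegral_add_right _ hCW'', lintegral_add_right _ hCW',
          lintegral_add_right _ hCW, e0, e1, e2, e3]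
        ring
    _ ≤ ∫⁻ T, centralTriples.indicator 1 T ∂cubeVolume := by
        refine lintegral_mono fun T => ?_
        by_cases h : T ∈ centralTriples
        · simpa [Set.indicator_of_mem h] using hF.indicator_add_earDensity_le h
        · simp [Set.indicator_of_notMem h]
    _ = 1 / 8 := by
        rw [lintegral_indicator_one measurableSet_centralTriples, cubeVolume_centralTriples]

theorem cubeVolume_le (hF : IsCrossingFamily F) (hm : MeasurableSet F) :
    cubeVolume F ≤ 1 / 4 := by
  set C := centralTriples ∩ F
  set E := shortTriples ∩ F
  set ρ : ℝ × ℝ × ℝ → ℝ × ℝ × ℝ := fun T => (T.2.1, T.2.2, T.1)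
  set τ : ℝ × ℝ × ℝ → ℝ × ℝ × ℝ := fun T => (T.2.1, T.1, T.2.2)
  have hρ : MeasurePreserving ρ cubeVolume cubeVolume := measurePreserving_rotate unitVolume
  have hτ : MeasurePreserving τ cubeVolume cubeVolume := measurePreserving_swap_fst_snd unitVolume
  have hCm : MeasurableSet C := measurableSet_centralTriples.inter hm
  have hEm : MeasurableSet E := measurableSet_shortTriples.inter hm
  -- `A` contains the positively oriented members of `F`; the transposition `τ` accounts for the
  -- others.
  set A := C ∪ (E ∪ (ρ ⁻¹' E ∪ ρ ⁻¹' (ρ ⁻¹' E)))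
  have hAm : MeasurableSet A := by
    refine hCm.union (hEm.union ((hρ.measurable hEm).union ?_))
    exact hρ.measurable (hρ.measurable hEm)
  have hA : cubeVolume A ≤ 1 / 8 := by
    refine le_trans ?_ (hF.cubeVolume_central_add_short_le hm)
    have h1 := hρ.measure_preimage hEm.nullMeasurableSet
    have h2 := hρ.measure_preimage (hρ.measurable hEm).nullMeasurableSet
    calc cubeVolume A ≤ cubeVolume C + (cubeVolume E + (cubeVolume (ρ ⁻¹' E) +
          cubeVolume (ρ ⁻¹' (ρ ⁻¹' E)))) :=
          (measure_union_le _ _).trans (by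
            gcongr
            refine (measure_union_le _ _).trans ?_
            gcongr
            exact measure_union_le _ _)
      _ = cubeVolume C + 3 * cubeVolume E := by rw [h2, h1]; ring
  have hcover : F ⊆ A ∪ τ ⁻¹' A := by
    rintro ⟨p, q, r⟩ h
    have h' := hF.swap h
    rcases hF.mem_central_or_short h with (h1 | h1 | h1 | h1) | (h1 | h1 | h1 | h1)
    · exact Or.inl (Or.inl ⟨h1, h⟩)
    · exact Or.inl (Or.inr (Or.inl ⟨h1, h⟩))
    · exact Or.inl (Or.inr (Or.inr (Or.inl ⟨h1, hF.rotate h⟩)))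
    · exact Or.inl (Or.inr (Or.inr (Or.inr ⟨h1, hF.rotate (hF.rotate h)⟩)))
    · exact Or.inr (Or.inl ⟨h1, h'⟩)
    · exact Or.inr (Or.inr (Or.inl ⟨h1, h'⟩))
    · exact Or.inr (Or.inr (Or.inr (Or.inl ⟨h1, hF.rotate h'⟩)))
    · exact Or.inr (Or.inr (Or.inr (Or.inr ⟨h1, hF.rotate (hF.rotate h')⟩)))
  calc cubeVolume F ≤ cubeVolume A + cubeVolume (τ ⁻¹' A) :=
        (measure_mono hcover).trans (measure_union_le _ _)
    _ = cubeVolume A + cubeVolume A := by rw [hτ.measure_preimage hAm.nullMeasurableSet]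
    _ ≤ 1 / 8 + 1 / 8 := by gcongr
    _ = 1 / 4 := by
        rw [ENNReal.div_add_div_same, ENNReal.div_eq_div_iff] <;> norm_num

end IsCrossingFamily

/-! ### Angles and separation of triangles in the plane -/

/-- The point of the unit circle at angle `θ`. -/
noncomputable def circlePoint (θ : ℝ) : UnitCircle :=
  ⟨!₂[Real.cos θ, Real.sin θ], by
    simp [EuclideanSpace.norm_eq]⟩

lemma continuous_circlePoint : Continuous circlePoint := by
  refine Continuous.subtype_mk ?_ _
  refine (PiLp.continuous_toLp 2 _).comp ?_
  refine continuous_pi fun i => ?_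
  fin_cases i
  · exact Real.continuous_cos
  · exact Real.continuous_sin

/-- The angle in `(-π, π]` of a point of the unit circle. -/
noncomputable def circleAngle (x : UnitCircle) : ℝ :=
  Complex.arg ⟨(x : EuclideanSpace ℝ (Fin 2)) 0, (x : EuclideanSpace ℝ (Fin 2)) 1⟩

lemma measurable_circleAngle : Measurable circleAngle := by
  refine Complex.measurable_arg.comp ?_
  have h : Measurable (fun x : UnitCircle => Complex.equivRealProd.symm
      ((x : EuclideanSpace ℝ (Fin 2)) 0, (x : EuclideanSpace ℝ (Fin 2)) 1)) := by
    refine (Continuous.measurable ?_)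
    refine Complex.equivRealProdCLM.symm.continuous.comp ?_
    fun_prop
  exact h

lemma circlePoint_circleAngle (x : UnitCircle) : circlePoint (circleAngle x) = x := by
  have hx : ‖(x : EuclideanSpace ℝ (Fin 2))‖ = 1 := by simp
  rw [EuclideanSpace.norm_eq, Real.sqrt_eq_one] at hx
  simp only [Real.norm_eq_abs, sq_abs, Fin.sum_univ_two] at hx
  set z : ℂ := ⟨(x : EuclideanSpace ℝ (Fin 2)) 0, (x : EuclideanSpace ℝ (Fin 2)) 1⟩ with hz
  have hn : ‖z‖ = 1 := by
    rw [Complex.norm_def, Real.sqrt_eq_one, Complex.normSq_apply, hz]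
    simp only
    linarith
  have h1 := Complex.norm_mul_cos_arg z
  have h2 := Complex.norm_mul_sin_arg z
  rw [hn, one_mul] at h1 h2
  apply Subtype.ext
  ext i
  fin_cases i
  · simpa [circlePoint, circleAngle] using h1
  · simpa [circlePoint, circleAngle] using h2

/-- Two triangles whose vertices lie on complementary closed arcs have disjoint interiors. -/
lemma disjoint_interior_triangle {T T' : UnitCircle × UnitCircle × UnitCircle}
    (m : EuclideanSpace ℝ (Fin 2)) (hm : m ≠ 0) (c : ℝ)
    (h : ∀ x ∈ ({T.1, T.2.1, T.2.2} : Set UnitCircle), c ≤ inner ℝ m (x : EuclideanSpace ℝ (Fin 2)))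
    (h' : ∀ x ∈ ({T'.1, T'.2.1, T'.2.2} : Set UnitCircle),
      inner ℝ m (x : EuclideanSpace ℝ (Fin 2)) ≤ c) :
    ¬ (interior (triangle T) ∩ interior (triangle T')).Nonempty := by
  rintro ⟨x, hx, hx'⟩
  have h1 : triangle T ⊆ {y | c ≤ inner ℝ m y} := by
    refine convexHull_min ?_ (convex_halfSpace_ge (innerₛₗ ℝ m).isLinear c)
    rintro y (rfl | rfl | rfl) <;> exact h _ (by simp)
  have h2 : triangle T' ⊆ {y | inner ℝ m y ≤ c} := by
    refine convexHull_min ?_ (convex_halfSpace_le (innerₛₗ ℝ m).isLinear c)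
    rintro y (rfl | rfl | rfl) <;> exact h' _ (by simp)
  have hopen : interior (triangle T) ∩ interior (triangle T') ∈ nhds x :=
    (isOpen_interior.inter isOpen_interior).mem_nhds ⟨hx, hx'⟩
  -- The half-planes are closed and share a line, so a common interior point is pushed slightly
  -- along `m`, out of the half-plane containing `triangle T'`.
  have hcont : Filter.Tendsto (fun t : ℝ => x + t • m) (nhdsWithin 0 (Set.Ioi 0)) (nhds x) := by
    have : Continuous (fun t : ℝ => x + t • m) := by fun_prop
    have h0 := (this.tendsto 0).mono_left (nhdsWithin_le_nhds (s := Set.Ioi 0))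
    simpa using h0
  obtain ⟨t, ht, ht0⟩ := ((hcont.eventually hopen).and self_mem_nhdsWithin).exists
  have e1 : c ≤ inner ℝ m x := h1 (interior_subset hx)
  have e2 : inner ℝ m (x + t • m) ≤ c := h2 (interior_subset ht.2)
  rw [inner_add_right, inner_smul_right, real_inner_self_eq_norm_sq] at e2
  have : 0 < t * ‖m‖ ^ 2 := mul_pos ht0 (by positivity)
  linarith

lemma inner_circlePoint (θ φ : ℝ) :
    inner ℝ (circlePoint θ : EuclideanSpace ℝ (Fin 2)) (circlePoint φ) = Real.cos (φ - θ) := by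
  simp [circlePoint, PiLp.inner_apply, Fin.sum_univ_two, Real.cos_sub]

/-- The separating line passes through the points at angles `α` and `β`: its normal points to the
arc's midpoint and its level is the cosine of half the arc's length. -/
lemma disjoint_interior_triangle_of_angles {α β a b c a' b' c' : ℝ} (hα : -Real.pi ≤ α)
    (hαβ : α ≤ β) (hβ : β ≤ Real.pi)
    (h : ∀ θ ∈ ({a, b, c} : Set ℝ), α ≤ θ ∧ θ ≤ β)
    (h' : ∀ θ ∈ ({a', b', c'} : Set ℝ), (-Real.pi ≤ θ ∧ θ ≤ Real.pi) ∧ (θ ≤ α ∨ β ≤ θ)) :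
    ¬ (interior (triangle (circlePoint a, circlePoint b, circlePoint c)) ∩
      interior (triangle (circlePoint a', circlePoint b', circlePoint c'))).Nonempty := by
  have key : ∀ θ, α ≤ θ → θ ≤ β →
      Real.cos ((β - α) / 2) ≤ Real.cos (θ - (α + β) / 2) := by
    intro θ h1 h2
    rw [← Real.cos_abs (θ - _)]
    apply Real.cos_le_cos_of_nonneg_of_le_pi (abs_nonneg _) (by linarith)
    rw [abs_le]; constructor <;> linarith
  have key' : ∀ θ, -Real.pi ≤ θ → θ ≤ Real.pi → (θ ≤ α ∨ β ≤ θ) →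
      Real.cos (θ - (α + β) / 2) ≤ Real.cos ((β - α) / 2) := by
    intro θ h1 h2 h3
    have : ∀ y, (β - α) / 2 ≤ y → y ≤ 2 * Real.pi - (β - α) / 2 →
        Real.cos y ≤ Real.cos ((β - α) / 2) := by
      intro y hy1 hy2
      rcases le_total y Real.pi with hy | hy
      · exact Real.cos_le_cos_of_nonneg_of_le_pi (by linarith) hy hy1
      · rw [← Real.cos_two_pi_sub y]
        exact Real.cos_le_cos_of_nonneg_of_le_pi (by linarith) (by linarith) (by linarith)
    rcases h3 with h3 | h3
    · rw [← Real.cos_neg]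
      apply this <;> linarith
    · apply this <;> linarith
  refine disjoint_interior_triangle (circlePoint ((α + β) / 2) : EuclideanSpace ℝ (Fin 2)) ?_
    (Real.cos ((β - α) / 2)) ?_ ?_
  · intro h0
    have := (circlePoint ((α + β) / 2)).2
    rw [h0] at this
    simp at this
  · rintro x (rfl | rfl | rfl) <;> simp only [inner_circlePoint] <;>
      exact key _ (h _ (by simp)).1 (h _ (by simp)).2
  · rintro x (rfl | rfl | rfl) <;> simp only [inner_circlePoint] <;>
      exact key' _ (h' _ (by simp)).1.1 (h' _ (by simp)).1.2 (h' _ (by simp)).2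

/-! ### Symmetrization and transfer to the unit interval -/

/-- The closure of a set of ordered triples under permutations of the entries. -/
def symmetrization {α : Type*} (F : Set (α × α × α)) : Set (α × α × α) :=
  {T | (T.1, T.2.1, T.2.2) ∈ F ∨ (T.2.1, T.2.2, T.1) ∈ F ∨ (T.2.2, T.1, T.2.1) ∈ F ∨
    (T.2.1, T.1, T.2.2) ∈ F ∨ (T.1, T.2.2, T.2.1) ∈ F ∨ (T.2.2, T.2.1, T.1) ∈ F}

lemma subset_symmetrization {α : Type*} (F : Set (α × α × α)) : F ⊆ symmetrization F :=
  fun _ h => Or.inl h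

lemma measurableSet_symmetrization {α : Type*} [MeasurableSpace α] {F : Set (α × α × α)}
    (hF : MeasurableSet F) : MeasurableSet (symmetrization F) := by
  have h : ∀ f : α × α × α → α × α × α, Measurable f → MeasurableSet {T | f T ∈ F} :=
    fun f hf => hf hF
  refine (h _ ?_).union ((h _ ?_).union ((h _ ?_).union ((h _ ?_).union ((h _ ?_).union
    (h _ ?_))))) <;> fun_prop

lemma exists_of_mem_symmetrization {α : Type*} {F : Set (α × α × α)} {a b c : α}
    (h : (a, b, c) ∈ symmetrization F) :
    ∃ a' b' c', (a', b', c') ∈ F ∧ ({a', b', c'} : Set α) = {a, b, c} := by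
  rcases h with h | h | h | h | h | h
  all_goals
    refine ⟨_, _, _, h, ?_⟩
    ext x
    simp only [Set.mem_insert_iff, Set.mem_singleton_iff] <;>
    tauto

lemma isIntersectingFamily_symmetrization
    {F : Set (UnitCircle × UnitCircle × UnitCircle)} (hF : IsIntersectingFamily F) :
    IsIntersectingFamily (symmetrization F) := by
  have key : ∀ T ∈ symmetrization F, ∃ T' ∈ F, triangle T' = triangle T := by
    rintro ⟨a, b, c⟩ h
    obtain ⟨a', b', c', h', hs⟩ := exists_of_mem_symmetrization h
    refine ⟨_, h', ?_⟩
    have := congrArg (fun s => convexHull ℝ ((↑) '' s : Set (EuclideanSpace ℝ (Fin 2)))) hs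
    simpa only [Set.image_insert_eq, Set.image_singleton, triangle] using this
  intro T hT T' hT'
  obtain ⟨S, hS, e⟩ := key T hT
  obtain ⟨S', hS', e'⟩ := key T' hT'
  rw [← e, ← e']
  exact hF S hS S' hS'

/-- The triples of `(0, 1)` that a parametrization of the circle by `(0, 1)` maps into the
symmetrization of `F`. -/
def parameterTriples {α : Type*} (φ : ℝ → α) (F : Set (α × α × α)) : Set (ℝ × ℝ × ℝ) :=
  (Set.Ioo 0 1 ×ˢ Set.Ioo 0 1 ×ˢ Set.Ioo 0 1) ∩
    (fun T => (φ T.1, φ T.2.1, φ T.2.2)) ⁻¹' symmetrization F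

/-- A weakly monotone `θ` preserves the closed inequalities that define complementary arcs, even
where it is constant, as at an atom. -/
lemma isCrossingFamily_parameterTriples {θ : ℝ → ℝ} (hθ : MonotoneOn θ (Set.Ioo 0 1))
    (hπ : ∀ u ∈ Set.Ioo (0 : ℝ) 1, -Real.pi ≤ θ u ∧ θ u ≤ Real.pi)
    {F : Set (UnitCircle × UnitCircle × UnitCircle)} (hF : IsIntersectingFamily F) :
    IsCrossingFamily (parameterTriples (circlePoint ∘ θ) F) where
  mem_Ioo := by
    rintro a b c ⟨⟨ha, hb, hc⟩, -⟩ x (rfl | rfl | rfl)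
    exacts [ha, hb, hc]
  swap := by
    rintro a b c ⟨⟨ha, hb, hc⟩, h⟩
    refine ⟨⟨hb, ha, hc⟩, ?_⟩
    simp only [Set.mem_preimage, symmetrization, Set.mem_ofPred_eq] at h ⊢
    tauto
  rotate := by
    rintro a b c ⟨⟨ha, hb, hc⟩, h⟩
    refine ⟨⟨hb, hc, ha⟩, ?_⟩
    simp only [Set.mem_preimage, symmetrization, Set.mem_ofPred_eq] at h ⊢
    tauto
  crossing := by
    rintro a b c a' b' c' u v hu hv huv ⟨⟨ha, hb, hc⟩, h⟩ ⟨⟨ha', hb', hc'⟩, h'⟩ hT hT'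
    refine disjoint_interior_triangle_of_angles (hπ u hu).1 (hθ hu hv huv) (hπ v hv).2 ?_ ?_
      (isIntersectingFamily_symmetrization hF _ h _ h')
    · have key : ∀ x ∈ Set.Ioo (0 : ℝ) 1, (u ≤ x ∧ x ≤ v) → θ u ≤ θ x ∧ θ x ≤ θ v :=
        fun x hx h => ⟨hθ hu hx h.1, hθ hx hv h.2⟩
      rintro _ (rfl | rfl | rfl)
      exacts [key a ha (hT a (by simp)), key b hb (hT b (by simp)), key c hc (hT c (by simp))]
    · have key : ∀ x ∈ Set.Ioo (0 : ℝ) 1, (x ≤ u ∨ v ≤ x) →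
          (-Real.pi ≤ θ x ∧ θ x ≤ Real.pi) ∧ (θ x ≤ θ u ∨ θ v ≤ θ x) :=
        fun x hx h => ⟨hπ x hx, h.imp (hθ hx hu) (hθ hv hx)⟩
      rintro _ (rfl | rfl | rfl)
      exacts [key a' ha' (hT' a' (by simp)), key b' hb' (hT' b' (by simp)),
        key c' hc' (hT' c' (by simp))]

lemma quantile_circleAngle_mem (ν : Measure UnitCircle) [IsProbabilityMeasure ν] {u : ℝ}
    (hu : u ∈ Set.Ioo (0 : ℝ) 1) :
    -Real.pi ≤ quantile (ν.map circleAngle) u ∧ quantile (ν.map circleAngle) u ≤ Real.pi := by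
  have : IsProbabilityMeasure (ν.map circleAngle) :=
    Measure.isProbabilityMeasure_map measurable_circleAngle.aemeasurable
  constructor
  · by_contra! h
    have h1 := (quantile_le_iff _ hu.1 hu.2 (-Real.pi)).1 h.le
    have h2 : cdf (ν.map circleAngle) (-Real.pi) = 0 := by
      rw [cdf_eq_real, measureReal_def,
        Measure.map_apply measurable_circleAngle measurableSet_Iic]
      have : circleAngle ⁻¹' Set.Iic (-Real.pi) = ∅ := by
        ext x
        simpa [circleAngle] using Complex.neg_pi_lt_arg _
      simp [this]
    linarith [hu.1]
  · rw [quantile_le_iff _ hu.1 hu.2, cdf_eq_real, measureReal_def,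
      Measure.map_apply measurable_circleAngle measurableSet_Iic]
    have : circleAngle ⁻¹' Set.Iic Real.pi = Set.univ := by
      ext x
      simpa [circleAngle] using Complex.arg_le_pi _
    simpa [this] using hu.2.le

theorem theorem3 (ν : Measure UnitCircle) [IsProbabilityMeasure ν]
    (F : Set (UnitCircle × UnitCircle × UnitCircle)) (hF : MeasurableSet F)
    (hint : IsIntersectingFamily F) :
    (ν.prod (ν.prod ν)) F ≤ 1 / 4 := by
  have : IsProbabilityMeasure (ν.map circleAngle) :=
    Measure.isProbabilityMeasure_map measurable_circleAngle.aemeasurable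
  set θ := quantile (ν.map circleAngle)
  have hφm : Measurable (circlePoint ∘ θ) :=
    continuous_circlePoint.measurable.comp (measurable_quantile _)
  have hφ : MeasurePreserving (circlePoint ∘ θ) unitVolume ν := by
    refine ⟨hφm, ?_⟩
    rw [← Measure.map_map continuous_circlePoint.measurable (measurable_quantile _),
      map_quantile, Measure.map_map continuous_circlePoint.measurable measurable_circleAngle]
    have : circlePoint ∘ circleAngle = id := funext circlePoint_circleAngle
    rw [this, Measure.map_id]
  have hφ3 := hφ.prod (hφ.prod hφ)
  have hcross := isCrossingFamily_parameterTriples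
    (monotoneOn_quantile _) (fun u hu => quantile_circleAngle_mem ν hu) hint
  have hm : MeasurableSet (parameterTriples (circlePoint ∘ θ) F) :=
    (measurableSet_Ioo.prod (measurableSet_Ioo.prod measurableSet_Ioo)).inter
      (hφ3.measurable (measurableSet_symmetrization hF))
  refine le_trans ?_ (hcross.cubeVolume_le hm)
  rw [← hφ3.measure_preimage hF.nullMeasurableSet]
  -- The inclusion holds only almost everywhere, because `parameterTriples` is confined to the open
  -- cube.
  refine measure_mono_ae ?_
  have hcube : ∀ᵐ T ∂cubeVolume, T ∈ Set.Ioo (0 : ℝ) 1 ×ˢ Set.Ioo (0 : ℝ) 1 ×ˢ Set.Ioo (0 : ℝ) 1 := by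
    have : cubeVolume = volume.restrict
        (Set.Ioo (0 : ℝ) 1 ×ˢ Set.Ioo (0 : ℝ) 1 ×ˢ Set.Ioo (0 : ℝ) 1) := by
      rw [cubeVolume, unitVolume, Measure.prod_restrict, Measure.prod_restrict]
      rfl
    rw [this]
    exact ae_restrict_mem
      (measurableSet_Ioo.prod (measurableSet_Ioo.prod measurableSet_Ioo))
  filter_upwards [hcube] with T hT hTF
  exact ⟨hT, subset_symmetrization F hTF⟩
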